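/- Let $n\ge 1$ and let $\mathfrak g=\bigoplus_{\bar\imath\in\mathbb Z/n\mathbb Z}\mathfrak g_{\bar\imath}$ be a $\mathbb Z/n\mathbb Z$-graded simple finite-dimensional complex Lie algebra, with a nonzero invariant symmetric bilinear form $B$. Let $\widehat{\mathfrak g}=\bigoplus_{i\in\mathbb Z}\mathfrak g_{i\,(\mathrm{mod}\,n)}\otimes t^i\subseteq \mathfrak g\otimes\mathbb C[t,t^{-1}]$ be the associated twisted loop algebra (the untwisted loop algebra if $n=1$), and let $$\mathscr L=\widehat{\mathfrak g}\oplus\mathbb C\,t\tfrac{d}{dt}\oplus\mathbb C z$$ be the corresponding affine Kac–Moody algebra: $z$ is central, $[t\frac{d}{dt},x\otimes t^i]=i\,x\otimes t^i$, and $$[x\otimes t^i,y\otimes t^j]=[x,y]\otimes t^{i+j}+i\,\delta_{i+j,0}\,B(x,y)\,z .$$ A CPA-structure (commutative post-Lie algebra structure) on a Lie algebra $L$ is a bilinear map $\varphi:L\times L\to L$ such that, for all $x,y,w\in L$, $$\varphi(x,y)=\varphi(y,x),\qquad \varphi(x,[y,w])=[\varphi(x,y),w]-[\varphi(x,w),y],$$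 $$\varphi([x,y],w)=\varphi(x,\varphi(y,w))-\varphi(y,\varphi(x,w)).$$ Then the CPA-structures on $\mathscr L$ form a one-dimensional vector space, spanned by the bilinear map $\mathscr L\times\mathscr L\to\mathscr L$ that sends $(t\frac{d}{dt},t\frac{d}{dt})$ to $z$ and all other pairs of basis elements (elements of a basis of $\widehat{\mathfrak g}$, together with $t\frac{d}{dt}$ and $z$) to $0$. -/

import Mathlib

open scoped TensorProduct

noncomputable section

/-- A commutative post-Lie algebra structure (CPA-structure) on a Lie algebra `L`: a bilinear map
`φ : L × L → L` that is commutative, is a derivation in its second argument, and satisfies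
`φ([x,y],z) = φ(x,φ(y,z)) - φ(y,φ(x,z))`. -/
structure IsCPAStructure {K L : Type*} [CommRing K] [LieRing L] [LieAlgebra K L]
    (φ : L →ₗ[K] L →ₗ[K] L) : Prop where
  comm : ∀ x y : L, φ x y = φ y x
  map_lie_right : ∀ x y z : L, φ x ⁅y, z⁆ = ⁅φ x y, z⁆ - ⁅φ x z, y⁆
  map_lie_left : ∀ x y z : L, φ ⁅x, y⁆ z = φ x (φ y z) - φ y (φ x z)

namespace KacMoody

open LieAlgebra LieAlgebra.LoopAlgebra

section Loop

variable {𝔤 : Type*} [LieRing 𝔤] [LieAlgebra ℂ 𝔤]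

/-- The coefficient in `𝔤` of `t ^ i` in an element of the loop algebra `ℂ[t,t⁻¹] ⊗ 𝔤`. -/
def coeff (f : loopAlgebra ℂ ℤ 𝔤) (i : ℤ) : 𝔤 := toFinsupp ℂ ℤ 𝔤 f i

/-- The element `x ⊗ t ^ i` of the loop algebra. -/
def mono (i : ℤ) (x : 𝔤) : loopAlgebra ℂ ℤ 𝔤 := AddMonoidAlgebra.single i (1 : ℂ) ⊗ₜ[ℂ] x

lemma coeff_add (f g : loopAlgebra ℂ ℤ 𝔤) (i : ℤ) :
    coeff (f + g) i = coeff f i + coeff g i := by simp [coeff]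

lemma coeff_smul (c : ℂ) (f : loopAlgebra ℂ ℤ 𝔤) (i : ℤ) :
    coeff (c • f) i = c • coeff f i := by simp [coeff]

lemma coeff_zero (i : ℤ) : coeff (0 : loopAlgebra ℂ ℤ 𝔤) i = 0 := by simp [coeff]

lemma coeff_mono (i j : ℤ) (x : 𝔤) : coeff (mono i x) j = if i = j then x else 0 := by
  rw [coeff, mono, toFinsupp_single_tmul, Finsupp.single_apply]

lemma eq_sum_mono (f : loopAlgebra ℂ ℤ 𝔤) :
    f = (toFinsupp ℂ ℤ 𝔤 f).sum fun i x ↦ mono i x := by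
  apply (toFinsupp ℂ ℤ 𝔤).injective
  rw [Finsupp.sum, map_sum]
  simp only [mono, toFinsupp_single_tmul]
  exact (Finsupp.sum_single _).symm

lemma ext_coeff {f g : loopAlgebra ℂ ℤ 𝔤} (h : ∀ i, coeff f i = coeff g i) : f = g :=
  (toFinsupp ℂ ℤ 𝔤).injective (Finsupp.ext h)

lemma loop_add_lie (f g h : loopAlgebra ℂ ℤ 𝔤) : ⁅f + g, h⁆ = ⁅f, h⁆ + ⁅g, h⁆ := add_lie f g h

lemma loop_lie_add (f g h : loopAlgebra ℂ ℤ 𝔤) : ⁅f, g + h⁆ = ⁅f, g⁆ + ⁅f, h⁆ := lie_add f g h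

lemma loop_zero_lie (f : loopAlgebra ℂ ℤ 𝔤) : ⁅(0 : loopAlgebra ℂ ℤ 𝔤), f⁆ = 0 := zero_lie f

lemma loop_lie_zero (f : loopAlgebra ℂ ℤ 𝔤) : ⁅f, (0 : loopAlgebra ℂ ℤ 𝔤)⁆ = 0 := lie_zero f

lemma loop_smul_lie (c : ℂ) (f g : loopAlgebra ℂ ℤ 𝔤) : ⁅c • f, g⁆ = c • ⁅f, g⁆ := smul_lie c f g

lemma loop_lie_smul (c : ℂ) (f g : loopAlgebra ℂ ℤ 𝔤) : ⁅f, c • g⁆ = c • ⁅f, g⁆ := lie_smul c f g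

lemma lie_mono (i j : ℤ) (x y : 𝔤) : ⁅mono i x, mono j y⁆ = mono (i + j) ⁅x, y⁆ := by
  rw [mono, mono, ExtendScalars.bracket_tmul, AddMonoidAlgebra.single_mul_single, mul_one, mono]

/-- The Euler derivation `t d/dt` of the Laurent polynomial algebra: `t ^ i ↦ i t ^ i`. -/
def laurentEuler : AddMonoidAlgebra ℂ ℤ →ₗ[ℂ] AddMonoidAlgebra ℂ ℤ :=
  (AddMonoidAlgebra.basis ℤ ℂ).constr ℂ fun i ↦ AddMonoidAlgebra.single i (i : ℂ)

/-- The Euler derivation `t d/dt` acting on the loop algebra through the Laurent factor. -/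
def euler : loopAlgebra ℂ ℤ 𝔤 →ₗ[ℂ] loopAlgebra ℂ ℤ 𝔤 :=
  LinearMap.rTensor 𝔤 laurentEuler

lemma euler_mono (i : ℤ) (x : 𝔤) : euler (mono i x) = (i : ℂ) • mono i x := by
  have h : laurentEuler (AddMonoidAlgebra.single i (1 : ℂ)) =
      (i : ℂ) • AddMonoidAlgebra.single i (1 : ℂ) := by
    have := (AddMonoidAlgebra.basis ℤ ℂ).constr_basis ℂ
      (fun i : ℤ ↦ AddMonoidAlgebra.single i (i : ℂ)) i
    rw [AddMonoidAlgebra.basis_apply] at this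
    rw [laurentEuler, this, AddMonoidAlgebra.smul_single, smul_eq_mul, mul_one]
  rw [euler, mono, LinearMap.rTensor_tmul, h, TensorProduct.smul_tmul']

lemma mono_induction {p : loopAlgebra ℂ ℤ 𝔤 → Prop} (f : loopAlgebra ℂ ℤ 𝔤)
    (h0 : p 0) (hadd : ∀ f g, p f → p g → p (f + g)) (hm : ∀ i x, p (mono i x)) : p f := by
  rw [eq_sum_mono f]
  exact Finset.sum_induction _ p hadd h0 fun i _ ↦ hm i _

lemma coeff_euler (f : loopAlgebra ℂ ℤ 𝔤) (i : ℤ) : coeff (euler f) i = (i : ℂ) • coeff f i := by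
  induction f using mono_induction with
  | h0 => simp [coeff_zero]
  | hadd f g hf hg => simp [coeff_add, hf, hg]
  | hm j x =>
    rw [euler_mono, coeff_smul, coeff_mono]
    split_ifs with h
    · rw [h]
    · simp

lemma euler_lie (f g : loopAlgebra ℂ ℤ 𝔤) : euler ⁅f, g⁆ = ⁅euler f, g⁆ + ⁅f, euler g⁆ := by
  induction f using mono_induction with
  | h0 => simp only [loop_zero_lie, map_zero, add_zero]
  | hadd f₁ f₂ h₁ h₂ => simp only [loop_add_lie, map_add, h₁, h₂]; abel
  | hm i x =>
    induction g using mono_induction with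
    | h0 => simp only [loop_lie_zero, map_zero, add_zero]
    | hadd g₁ g₂ h₁ h₂ => simp only [loop_lie_add, map_add, h₁, h₂]; abel
    | hm j y =>
      rw [lie_mono, euler_mono, euler_mono, euler_mono, loop_smul_lie, loop_lie_smul, lie_mono, ← add_smul]
      push_cast
      rfl

/-- The cocycle attached to a bilinear form `B` on `𝔤`:
`(x ⊗ t ^ i, y ⊗ t ^ j) ↦ i δ_{i + j, 0} B(y, x)`. For symmetric invariant `B` this is the
Kac–Moody cocycle. -/
def cocycle (B : LinearMap.BilinForm ℂ 𝔤) : LinearMap.BilinForm ℂ (loopAlgebra ℂ ℤ 𝔤) :=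
  (residuePairing ℂ ℤ 𝔤 B).flip

lemma cocycle_apply (B : LinearMap.BilinForm ℂ 𝔤) (f g : loopAlgebra ℂ ℤ 𝔤) :
    cocycle B f g = (toFinsupp ℂ ℤ 𝔤 f).sum fun i x ↦ i • B (toFinsupp ℂ ℤ 𝔤 g (-i)) x := rfl

lemma cocycle_mono (B : LinearMap.BilinForm ℂ 𝔤) (i j : ℤ) (x y : 𝔤) :
    cocycle B (mono i x) (mono j y) = if i + j = 0 then (i : ℂ) * B y x else 0 := by
  have h : j = -i ↔ i + j = 0 := by omega
  rw [cocycle_apply, mono, mono, toFinsupp_single_tmul, toFinsupp_single_tmul,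
    Finsupp.sum_single_index (by simp), Finsupp.single_apply]
  simp only [h]
  split_ifs <;> simp

lemma cocycle_self {B : LinearMap.BilinForm ℂ 𝔤} (hs : B.IsSymm) (f : loopAlgebra ℂ ℤ 𝔤) :
    cocycle B f f = 0 := by
  have h := LieModule.Cohomology.twoCochain_alt (twoCochainOfBilinear ℂ ℤ 𝔤 B hs) f
  exact (TrivialLieModule.equiv ℂ (loopAlgebra ℂ ℤ 𝔤) ℂ).symm.injective (h.trans (map_zero _).symm)

lemma cocycle_skew {B : LinearMap.BilinForm ℂ 𝔤} (hs : B.IsSymm) (f g : loopAlgebra ℂ ℤ 𝔤) :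
    cocycle B f g = - cocycle B g f := by
  have h := cocycle_self hs (f + g)
  simp only [map_add, LinearMap.add_apply, cocycle_self hs, zero_add, add_zero] at h
  linear_combination h

lemma cocycle_euler (B : LinearMap.BilinForm ℂ 𝔤) (f g : loopAlgebra ℂ ℤ 𝔤) :
    cocycle B (euler f) g + cocycle B f (euler g) = 0 := by
  induction f using mono_induction with
  | h0 => simp
  | hadd f₁ f₂ h₁ h₂ =>
    simp only [map_add, LinearMap.add_apply]
    linear_combination h₁ + h₂
  | hm i x =>
    induction g using mono_induction with
    | h0 => simp
    | hadd g₁ g₂ h₁ h₂ =>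
      simp only [map_add]
      linear_combination h₁ + h₂
    | hm j y =>
      simp only [euler_mono, map_smul, LinearMap.smul_apply, cocycle_mono, smul_eq_mul]
      split_ifs with h
      · have : (i : ℂ) + j = 0 := by exact_mod_cast h
        linear_combination (i : ℂ) * B y x * this
      · simp

lemma cocycle_lie {B : LinearMap.BilinForm ℂ 𝔤} (hB : B.lieInvariant 𝔤)
    (f g h : loopAlgebra ℂ ℤ 𝔤) :
    cocycle B f ⁅g, h⁆ = cocycle B ⁅f, g⁆ h + cocycle B g ⁅f, h⁆ := by
  induction f using mono_induction with
  | h0 => simp only [loop_zero_lie, map_zero, LinearMap.zero_apply, add_zero]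
  | hadd f₁ f₂ h₁ h₂ =>
    simp only [map_add, loop_add_lie, LinearMap.add_apply]
    linear_combination h₁ + h₂
  | hm i x =>
    induction g using mono_induction with
    | h0 => simp only [loop_zero_lie, loop_lie_zero, map_zero, LinearMap.zero_apply, add_zero]
    | hadd g₁ g₂ h₁ h₂ =>
      simp only [map_add, loop_add_lie, loop_lie_add, LinearMap.add_apply]
      linear_combination h₁ + h₂
    | hm j y =>
      induction h using mono_induction with
      | h0 => simp only [loop_lie_zero, map_zero, add_zero]
      | hadd g₁ g₂ h₁ h₂ =>
        simp only [map_add, loop_lie_add]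
        linear_combination h₁ + h₂
      | hm k z =>
        simp only [lie_mono, cocycle_mono]
        have e1 : i + (j + k) = 0 ↔ i + j + k = 0 := by omega
        have e2 : j + (i + k) = 0 ↔ i + j + k = 0 := by omega
        simp only [e1, e2]
        split_ifs with hh
        · have a1 : B ⁅x, z⁆ y = - B z ⁅x, y⁆ := hB x z y
          have a2 : B ⁅y, z⁆ x = B z ⁅x, y⁆ := by
            rw [hB y z x, ← lie_skew x y, map_neg]
          rw [a1, a2]
          push_cast
          ring
        · simp

end Loop

section Affine

variable {n : ℕ} {𝔤 : Type*} [LieRing 𝔤] [LieAlgebra ℂ 𝔤]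
variable (𝒢 : ZMod n → Submodule ℂ 𝔤) [GradedLieAlgebra 𝒢]

/-- The twisted loop algebra `⨁ i : ℤ, 𝒢 (i mod n) ⊗ t ^ i` of a `ℤ/nℤ`-graded Lie algebra, as a
subalgebra of the loop algebra. -/
def twistedLoop : LieSubalgebra ℂ (loopAlgebra ℂ ℤ 𝔤) where
  carrier := {f | ∀ i : ℤ, coeff f i ∈ 𝒢 (i : ZMod n)}
  add_mem' {f g} hf hg i := by rw [coeff_add]; exact add_mem (hf i) (hg i)
  zero_mem' i := by rw [coeff_zero]; exact zero_mem _
  smul_mem' c f hf i := by rw [coeff_smul]; exact Submodule.smul_mem _ c (hf i)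
  lie_mem' {f g} hf hg k := by
    have hlie : ⁅f, g⁆ = ∑ i ∈ (toFinsupp ℂ ℤ 𝔤 f).support, ∑ j ∈ (toFinsupp ℂ ℤ 𝔤 g).support,
        ⁅mono i (coeff f i), mono j (coeff g j)⁆ := by
      conv_lhs => rw [eq_sum_mono f, eq_sum_mono g, Finsupp.sum, Finsupp.sum]
      exact _root_.sum_lie_sum _ _ _ _
    rw [hlie]
    have hsum (s : Finset ℤ) (F : ℤ → loopAlgebra ℂ ℤ 𝔤)
        (hF : ∀ i ∈ s, coeff (F i) k ∈ 𝒢 (k : ZMod n)) :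
        coeff (∑ i ∈ s, F i) k ∈ 𝒢 (k : ZMod n) := by
      refine Finset.sum_induction F (fun x ↦ coeff x k ∈ 𝒢 (k : ZMod n)) ?_ ?_ hF
      · intro a b ha hb
        rw [coeff_add]
        exact add_mem ha hb
      · rw [coeff_zero]
        exact zero_mem _
    refine hsum _ _ fun i _ ↦ hsum _ _ fun j _ ↦ ?_
    rw [lie_mono, coeff_mono]
    split_ifs with h
    · rw [← h, Int.cast_add]
      exact SetLike.GradedBracket.bracket_mem (hf i) (hg j)
    · exact zero_mem _

/-- The Euler derivation restricted to the twisted loop algebra. -/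
def twistedEuler : twistedLoop 𝒢 →ₗ[ℂ] twistedLoop 𝒢 :=
  euler.restrict (p := (twistedLoop 𝒢).toSubmodule) (q := (twistedLoop 𝒢).toSubmodule)
    fun f hf i ↦ by
      rw [coeff_euler]
      exact Submodule.smul_mem _ _ (hf i)

lemma coe_twistedEuler (f : twistedLoop 𝒢) :
    (twistedEuler 𝒢 f : loopAlgebra ℂ ℤ 𝔤) = euler (f : loopAlgebra ℂ ℤ 𝔤) := rfl

lemma twistedEuler_lie (f g : twistedLoop 𝒢) :
    twistedEuler 𝒢 ⁅f, g⁆ = ⁅twistedEuler 𝒢 f, g⁆ + ⁅f, twistedEuler 𝒢 g⁆ :=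
  Subtype.ext (euler_lie f.1 g.1)

/-- The affine Kac–Moody algebra `ĝ ⊕ ℂ t d/dt ⊕ ℂ z`, where `ĝ` is the twisted loop algebra of the
graded Lie algebra `𝔤` and the central extension is taken with respect to the invariant symmetric
bilinear form `B`. The triple `⟨f, a, c⟩` stands for `f + a t d/dt + c z`. -/
@[ext]
structure AffineAlgebra (B : LinearMap.BilinForm ℂ 𝔤) (_hB : B.lieInvariant 𝔤)
    (_hs : B.IsSymm) where
  /-- The component in the twisted loop algebra. -/
  loop : twistedLoop 𝒢
  /-- The coefficient of `t d/dt`. -/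
  dCoeff : ℂ
  /-- The coefficient of `z`. -/
  zCoeff : ℂ

namespace AffineAlgebra

variable {𝒢} {B : LinearMap.BilinForm ℂ 𝔤} {hB : B.lieInvariant 𝔤} {hs : B.IsSymm}

/-- The underlying triple. -/
def toTriple : AffineAlgebra 𝒢 B hB hs ≃ twistedLoop 𝒢 × ℂ × ℂ where
  toFun u := (u.loop, u.dCoeff, u.zCoeff)
  invFun p := ⟨p.1, p.2.1, p.2.2⟩
  left_inv _ := rfl
  right_inv _ := rfl

instance : AddCommGroup (AffineAlgebra 𝒢 B hB hs) := toTriple.addCommGroup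

instance : Module ℂ (AffineAlgebra 𝒢 B hB hs) := toTriple.module ℂ

@[simp] lemma add_loop (u v : AffineAlgebra 𝒢 B hB hs) : (u + v).loop = u.loop + v.loop := rfl
@[simp] lemma add_dCoeff (u v : AffineAlgebra 𝒢 B hB hs) :
    (u + v).dCoeff = u.dCoeff + v.dCoeff := rfl
@[simp] lemma add_zCoeff (u v : AffineAlgebra 𝒢 B hB hs) :
    (u + v).zCoeff = u.zCoeff + v.zCoeff := rfl
@[simp] lemma zero_loop : (0 : AffineAlgebra 𝒢 B hB hs).loop = 0 := rfl
@[simp] lemma zero_dCoeff : (0 : AffineAlgebra 𝒢 B hB hs).dCoeff = 0 := rfl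
@[simp] lemma zero_zCoeff : (0 : AffineAlgebra 𝒢 B hB hs).zCoeff = 0 := rfl
@[simp] lemma sub_loop (u v : AffineAlgebra 𝒢 B hB hs) :
    (u - v).loop = u.loop - v.loop := rfl
@[simp] lemma sub_dCoeff (u v : AffineAlgebra 𝒢 B hB hs) :
    (u - v).dCoeff = u.dCoeff - v.dCoeff := rfl
@[simp] lemma sub_zCoeff (u v : AffineAlgebra 𝒢 B hB hs) :
    (u - v).zCoeff = u.zCoeff - v.zCoeff := rfl
@[simp] lemma smul_loop (c : ℂ) (u : AffineAlgebra 𝒢 B hB hs) : (c • u).loop = c • u.loop := rfl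
@[simp] lemma smul_dCoeff (c : ℂ) (u : AffineAlgebra 𝒢 B hB hs) :
    (c • u).dCoeff = c * u.dCoeff := rfl
@[simp] lemma smul_zCoeff (c : ℂ) (u : AffineAlgebra 𝒢 B hB hs) :
    (c • u).zCoeff = c * u.zCoeff := rfl

/-- The bracket: `z` is central, `t d/dt` acts on `ĝ` as the Euler derivation, and the bracket of
`f, g ∈ ĝ` is the loop bracket plus the cocycle times `z`. -/
instance : Bracket (AffineAlgebra 𝒢 B hB hs) (AffineAlgebra 𝒢 B hB hs) where
  bracket u v :=
    ⟨⁅u.loop, v.loop⁆ + u.dCoeff • twistedEuler 𝒢 v.loop - v.dCoeff • twistedEuler 𝒢 u.loop,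
      0, cocycle B u.loop v.loop⟩

@[simp] lemma lie_loop (u v : AffineAlgebra 𝒢 B hB hs) :
    ⁅u, v⁆.loop = ⁅u.loop, v.loop⁆ + u.dCoeff • twistedEuler 𝒢 v.loop -
      v.dCoeff • twistedEuler 𝒢 u.loop := rfl
@[simp] lemma lie_dCoeff (u v : AffineAlgebra 𝒢 B hB hs) : ⁅u, v⁆.dCoeff = 0 := rfl
@[simp] lemma lie_zCoeff (u v : AffineAlgebra 𝒢 B hB hs) :
    ⁅u, v⁆.zCoeff = cocycle B u.loop v.loop := rfl

instance : LieRing (AffineAlgebra 𝒢 B hB hs) where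
  add_lie u v w := by
    ext1
    · simp only [lie_loop, add_loop, add_dCoeff, add_lie, add_smul, map_add, smul_add]
      abel
    · simp
    · simp
  lie_add u v w := by
    ext1
    · simp only [lie_loop, add_loop, add_dCoeff, lie_add, add_smul, map_add, smul_add]
      abel
    · simp
    · simp
  lie_self u := by
    ext1
    · simp
    · simp
    · simpa using cocycle_self hs _
  leibniz_lie u v w := by
    ext1
    · simp only [lie_loop, add_loop, lie_dCoeff, zero_smul, sub_zero, add_zero, lie_add, lie_sub,
        add_lie, sub_lie, lie_smul, smul_lie, map_add, map_sub, map_smul, twistedEuler_lie,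
        smul_add, smul_sub, leibniz_lie u.loop v.loop w.loop]
      rw [← lie_skew (twistedEuler 𝒢 u.loop) v.loop, smul_comm v.dCoeff u.dCoeff,
        smul_comm w.dCoeff u.dCoeff, smul_comm w.dCoeff v.dCoeff, smul_neg]
      abel
    · simp
    · have h1 := cocycle_euler B (v.loop : loopAlgebra ℂ ℤ 𝔤) w.loop
      have h2 := cocycle_euler B (u.loop : loopAlgebra ℂ ℤ 𝔤) w.loop
      have h3 := cocycle_euler B (u.loop : loopAlgebra ℂ ℤ 𝔤) v.loop
      have h4 := cocycle_skew hs (euler (u.loop : loopAlgebra ℂ ℤ 𝔤)) v.loop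
      have h5 := cocycle_lie hB (u.loop : loopAlgebra ℂ ℤ 𝔤) v.loop w.loop
      simp only [lie_zCoeff, lie_loop, add_zCoeff, LieSubalgebra.coe_bracket,
        AddSubgroupClass.coe_sub, AddMemClass.coe_add, SetLike.val_smul, coe_twistedEuler,
        map_add, map_sub, map_smul, LinearMap.add_apply, LinearMap.sub_apply,
        LinearMap.smul_apply, smul_eq_mul]
      linear_combination h5 + v.dCoeff * h2 - u.dCoeff * h1 - w.dCoeff * h3 + w.dCoeff * h4

instance : LieAlgebra ℂ (AffineAlgebra 𝒢 B hB hs) where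
  lie_smul c u v := by
    ext1
    · simp only [lie_loop, smul_loop, smul_dCoeff, lie_smul, map_smul, smul_sub, smul_add,
        mul_smul]
      rw [smul_comm c u.dCoeff]
    · simp
    · simp

variable (𝒢 B hB hs)

/-- The basis element `t d/dt`. -/
def d : AffineAlgebra 𝒢 B hB hs := ⟨0, 1, 0⟩

/-- The central basis element `z`. -/
def z : AffineAlgebra 𝒢 B hB hs := ⟨0, 0, 1⟩

/-- The bilinear map sending `(t d/dt, t d/dt)` to `z` and every other pair of basis elements
to `0`. -/
def eulerSquare : AffineAlgebra 𝒢 B hB hs →ₗ[ℂ]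
    AffineAlgebra 𝒢 B hB hs →ₗ[ℂ] AffineAlgebra 𝒢 B hB hs :=
  LinearMap.mk₂ ℂ (fun u v ↦ (u.dCoeff * v.dCoeff) • z 𝒢 B hB hs)
    (fun u v w ↦ by simp [add_mul, add_smul])
    (fun c u v ↦ by simp [mul_assoc, mul_smul])
    (fun u v w ↦ by simp [mul_add, add_smul])
    (fun c u v ↦ by simp [mul_left_comm, mul_smul])

lemma eulerSquare_apply (u v : AffineAlgebra 𝒢 B hB hs) :
    eulerSquare 𝒢 B hB hs u v = (u.dCoeff * v.dCoeff) • z 𝒢 B hB hs := rfl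

end AffineAlgebra

end Affine

end KacMoody

end

noncomputable section

namespace KacMoody

open LieAlgebra LieAlgebra.LoopAlgebra

/-! ### Invariant forms on a simple Lie algebra -/

section Simple

variable {K 𝔤 : Type*} [Field K] [LieRing 𝔤] [LieAlgebra K 𝔤]

/-! Write `d` for `t d/dt`; the eigenspaces of `ad d` grade the affine algebra by ℤ. Each `Φ u` is a
derivation, so applying it to `⁅d, x⁆ = i x` expresses the components of `Φ u x` of degree other
than `i` through `Φ u d`. Doing this in both variables, commutativity of `Φ` becomes a system of
identities between double brackets whose coefficients are polynomials in the degrees.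

Such identities are very restrictive because the coefficient space of `t ^ i` depends only on `i`
mod `n`: the exponent can be shifted by a multiple of `n` while the elements of 𝔤 stay fixed, and
subtracting the two instances isolates a bracket that must vanish. Triviality of the center of 𝔤
then finishes (`eq_zero_of_forall_smul_lie_lie_eq`, `eq_smul_z_of_forall_lie_eq_zero`).

In this way `Φ d d` has no component of nonzero degree (`comp_map_d_d_eq_zero`), then `Φ d` kills
all nonzero degrees (`map_d_eq_zero`). Hence `Φ x y` has both the degree of `x` and that of `y`,
vanishes when these differ, and is otherwise central (`map_eq_smul_z`). Central values force `Φ` to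
vanish on brackets; since the derived algebra is the kernel of the `d`-coefficient
(`eq_dCoeff_smul_of_forall_map_lie_eq_zero`), only the value `Φ d d`, a multiple of `z`, survives.
-/

lemma eq_zero_of_forall_lie_eq_zero [LieAlgebra.IsSimple K 𝔤] {x : 𝔤} (h : ∀ y : 𝔤, ⁅x, y⁆ = 0) :
    x = 0 := by
  have hx : x ∈ LieAlgebra.center K 𝔤 := fun y ↦ by rw [← lie_skew, h, neg_zero]
  rwa [LieAlgebra.center_eq_bot, LieSubmodule.mem_bot] at hx

/-- An invariant bilinear form on a simple Lie algebra that is degenerate on the left vanishes. -/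
lemma eq_zero_of_lieInvariant_of_apply_eq_zero [LieAlgebra.IsSimple K 𝔤]
    {B : LinearMap.BilinForm K 𝔤} (hB : B.lieInvariant 𝔤) {x : 𝔤} (hx : x ≠ 0)
    (h : B x = 0) : B = 0 := by
  let I : LieIdeal K 𝔤 :=
    { B.ker with
      lie_mem := fun {x m} hm ↦ by
        ext y
        have hm : B m = 0 := hm
        rw [hB, hm]
        simp }
  have hI : I = ⊤ := (LieAlgebra.IsSimple.eq_bot_or_eq_top I).resolve_left fun hI ↦ hx <| by
    have : x ∈ I := h
    rwa [hI, LieSubmodule.mem_bot] at this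
  ext y z
  have : y ∈ I := hI ▸ LieSubmodule.mem_top y
  exact congrArg (· z) (show B y = 0 from this)

/-- An invariant bilinear form on a simple Lie algebra is a multiple of the Killing form. -/
lemma exists_eq_smul_killingForm [IsAlgClosed K] [CharZero K] [FiniteDimensional K 𝔤]
    [LieAlgebra.IsSimple K 𝔤] {B : LinearMap.BilinForm K 𝔤} (hB : B.lieInvariant 𝔤) :
    ∃ c : K, B = c • killingForm K 𝔤 := by
  have hnd : (killingForm K 𝔤).Nondegenerate := LieAlgebra.IsKilling.killingForm_nondegenerate K 𝔤
  have : Nontrivial 𝔤 := by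
    by_contra h
    rw [not_nontrivial_iff_subsingleton] at h
    exact LieAlgebra.IsSimple.non_abelian K (L := 𝔤) ⟨fun x y ↦ Subsingleton.elim _ _⟩
  -- Schur's argument: an eigenvector of `T` with eigenvalue `c` lies in the kernel of the invariant
  -- form `B - c • killingForm`.
  let T : Module.End K 𝔤 := ((killingForm K 𝔤).toDual hnd).symm.toLinearMap ∘ₗ B
  obtain ⟨c, hc⟩ := Module.End.exists_eigenvalue T
  obtain ⟨x, hx⟩ := hc.exists_hasEigenvector
  refine ⟨c, sub_eq_zero.mp (eq_zero_of_lieInvariant_of_apply_eq_zero ?_ hx.2 (x := x) ?_)⟩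
  · intro x y z
    have hK := LieModule.traceForm_lieInvariant K 𝔤 𝔤 x y z
    simp only [LinearMap.sub_apply, LinearMap.smul_apply, hB x y z, hK, smul_neg]
    ring
  · have h1 : T x = c • x := hx.apply_eq_smul
    have h2 : B x = killingForm K 𝔤 (T x) := by
      ext y
      exact (LinearMap.BilinForm.apply_toDual_symm_apply (hB := hnd) _ _).symm
    rw [LinearMap.sub_apply, h2, h1, LinearMap.smul_apply, map_smul, sub_self]

end Simple

/-! ### Graded simple Lie algebras -/

section Graded

variable {ι K 𝔤 : Type*} [DecidableEq ι] [AddCommGroup ι] [Field K] [LieRing 𝔤] [LieAlgebra K 𝔤]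
  (𝒢 : ι → Submodule K 𝔤) [GradedLieAlgebra 𝒢]

lemma induction_homogeneous {p : 𝔤 → Prop} (x : 𝔤) (hadd : ∀ x y, p x → p y → p (x + y))
    (hm : ∀ i, ∀ x ∈ 𝒢 i, p x) : p x :=
  DirectSum.Decomposition.inductionOn 𝒢 (hm 0 0 (zero_mem _)) (fun {i} m ↦ hm i m m.2) hadd x

lemma eq_zero_of_forall_lie_homogeneous_eq_zero [LieAlgebra.IsSimple K 𝔤] {x : 𝔤}
    (h : ∀ i, ∀ y ∈ 𝒢 i, ⁅x, y⁆ = 0) : x = 0 :=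
  eq_zero_of_forall_lie_eq_zero (K := K) fun y ↦ induction_homogeneous 𝒢 y
    (fun a b ha hb ↦ by rw [lie_add, ha, hb, add_zero]) h

/-- `ad x ∘ ad y` shifts every graded component by `i + j ≠ 0`, so it has no diagonal blocks and its
trace is zero. -/
lemma killingForm_apply_eq_zero_of_add_ne_zero [FiniteDimensional K 𝔤] {i j : ι} (hij : i + j ≠ 0)
    {x y : 𝔤} (hx : x ∈ 𝒢 i) (hy : y ∈ 𝒢 j) : killingForm K 𝔤 x y = 0 := by
  rw [killingForm_apply_apply]
  refine LinearMap.trace_eq_zero_of_mapsTo_ne (DirectSum.Decomposition.isInternal 𝒢)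
    (fun k ↦ i + (j + k)) (fun k h ↦ hij ?_) fun k z hz ↦ ?_
  · rwa [← add_assoc, add_eq_right] at h
  · exact SetLike.GradedBracket.bracket_mem hx (SetLike.GradedBracket.bracket_mem hy hz)

/-- A nonzero invariant form on a graded simple Lie algebra pairs some pair of opposite graded
components nontrivially. -/
lemma exists_homogeneous_apply_ne_zero [IsAlgClosed K] [CharZero K] [FiniteDimensional K 𝔤]
    [LieAlgebra.IsSimple K 𝔤] {B : LinearMap.BilinForm K 𝔤} (hB : B.lieInvariant 𝔤) (hB0 : B ≠ 0) :
    ∃ i, ∃ x ∈ 𝒢 i, ∃ y ∈ 𝒢 (-i), B x y ≠ 0 := by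
  by_contra! h
  refine hB0 (LinearMap.ext₂ fun x y ↦ ?_)
  -- Compatibility of `B` with the grading is not assumed; it is inherited from the Killing form.
  obtain ⟨c, rfl⟩ := exists_eq_smul_killingForm hB
  rw [LinearMap.zero_apply, LinearMap.zero_apply]
  refine induction_homogeneous (p := fun x ↦ (c • killingForm K 𝔤) x y = 0) 𝒢 x (fun a b ha hb ↦ ?_) fun i x hx ↦
    induction_homogeneous (p := fun y ↦ (c • killingForm K 𝔤) x y = 0) 𝒢 y (fun a b ha hb ↦ ?_) fun j y hy ↦ ?_
  · rw [map_add, LinearMap.add_apply, ha, hb]; simp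
  · rw [map_add, ha, hb]; simp
  · by_cases hij : i + j = 0
    · obtain rfl := eq_neg_of_add_eq_zero_right hij
      exact h i x hx y hy
    · simp [killingForm_apply_eq_zero_of_add_ne_zero 𝒢 hij hx hy]

/-- A linear map on a simple Lie algebra vanishing on brackets of homogeneous elements is zero. -/
lemma eq_zero_of_forall_map_lie_homogeneous [LieAlgebra.IsSimple K 𝔤] {M : Type*} [AddCommGroup M]
    [Module K M] (f : 𝔤 →ₗ[K] M) (h : ∀ i, ∀ x ∈ 𝒢 i, ∀ j, ∀ y ∈ 𝒢 j, f ⁅x, y⁆ = 0) : f = 0 := by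
  have hxy (x y : 𝔤) : f ⁅x, y⁆ = 0 := by
    refine induction_homogeneous 𝒢 x (fun a b ha hb ↦ ?_) fun i x hx ↦
      induction_homogeneous 𝒢 y (fun a b ha hb ↦ ?_) fun j y hy ↦ h i x hx j y hy
    · rw [add_lie, map_add, ha, hb, add_zero]
    · rw [lie_add, map_add, ha, hb, add_zero]
  have htop : ⁅(⊤ : LieIdeal K 𝔤), (⊤ : LieIdeal K 𝔤)⁆ = ⊤ := by
    refine (LieAlgebra.IsSimple.eq_bot_or_eq_top _).resolve_left fun hb ↦
      LieAlgebra.IsSimple.non_abelian K (L := 𝔤) ⟨fun x y ↦ ?_⟩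
    have := LieSubmodule.lie_mem_lie (LieSubmodule.mem_top (R := K) x : x ∈ (⊤ : LieIdeal K 𝔤))
      (LieSubmodule.mem_top (R := K) y : y ∈ (⊤ : LieIdeal K 𝔤))
    rwa [hb, LieSubmodule.mem_bot] at this
  ext x
  have hx : x ∈ (⁅(⊤ : LieIdeal K 𝔤), (⊤ : LieIdeal K 𝔤)⁆ : LieIdeal K 𝔤).toSubmodule := by
    rw [htop]; trivial
  rw [LieSubmodule.lieIdeal_oper_eq_linear_span] at hx
  refine Submodule.span_induction ?_ (map_zero f) (fun a b _ _ ha hb ↦ ?_) (fun c a _ ha ↦ ?_) hx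
  · rintro _ ⟨a, b, rfl⟩
    exact hxy a b
  · rw [map_add, ha, hb]; simp
  · rw [map_smul, ha]; simp

end Graded

/-- Supplies a second exponent in the same residue class, so that one element of 𝔤 can be placed in
two different loop degrees. -/
lemma exists_intCast_eq_notMem {n : ℕ} [NeZero n] (s : ZMod n) (S : Finset ℤ) :
    ∃ i : ℤ, (i : ZMod n) = s ∧ i ∉ S := by
  have hinf : (Set.range fun q : ℤ ↦ (s.val : ℤ) + n * q).Infinite :=
    Set.infinite_range_of_injective fun a b h ↦ by
      simpa [NeZero.ne n] using h
  obtain ⟨_, ⟨q, rfl⟩, hq⟩ := hinf.exists_notMem_finset S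
  exact ⟨_, by simp, hq⟩

section LoopMono

variable {𝔤 : Type*} [LieRing 𝔤] [LieAlgebra ℂ 𝔤]

/-- The map `x ↦ x ⊗ t ^ i` as a linear map. -/
def monoLinear (i : ℤ) : 𝔤 →ₗ[ℂ] loopAlgebra ℂ ℤ 𝔤 :=
  TensorProduct.mk ℂ _ 𝔤 (AddMonoidAlgebra.single i (1 : ℂ))

lemma coeff_lie_mono (f : loopAlgebra ℂ ℤ 𝔤) (j : ℤ) (y : 𝔤) (m : ℤ) :
    coeff ⁅f, mono j y⁆ (m + j) = ⁅coeff f m, y⁆ := by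
  induction f using mono_induction with
  | h0 => rw [loop_zero_lie, coeff_zero, coeff_zero, zero_lie]
  | hadd f g hf hg => rw [loop_add_lie, coeff_add, coeff_add, hf, hg, add_lie]
  | hm i x =>
    rw [lie_mono, coeff_mono, coeff_mono]
    by_cases h : i = m
    · simp [h]
    · rw [if_neg h, if_neg (by omega), zero_lie]

end LoopMono

/-! ### The ℤ-grading of the affine algebra by `ad (t d/dt)` -/

namespace AffineAlgebra

variable {n : ℕ} {𝔤 : Type*} [LieRing 𝔤] [LieAlgebra ℂ 𝔤]
  {𝒢 : ZMod n → Submodule ℂ 𝔤} [GradedLieAlgebra 𝒢]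
  {B : LinearMap.BilinForm ℂ 𝔤} {hB : B.lieInvariant 𝔤} {hs : B.IsSymm}

/-- An element of the affine algebra is homogeneous of degree `i` if it is an eigenvector of
`ad (t d/dt)` with eigenvalue `i`. -/
def IsHomogeneous (i : ℤ) (u : AffineAlgebra 𝒢 B hB hs) : Prop :=
  ⁅d 𝒢 B hB hs, u⁆ = (i : ℂ) • u

variable (𝒢) in
lemma mono_mem_twistedLoop {i : ℤ} {x : 𝔤} (hx : x ∈ 𝒢 (i : ZMod n)) :
    mono i x ∈ twistedLoop 𝒢 := fun j ↦ by
  rw [coeff_mono]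
  split_ifs with h
  · exact h ▸ hx
  · exact zero_mem _

variable (𝒢 B hB hs) in
/-- The element `x ⊗ t ^ i` of the affine algebra, for `x` of degree `i mod n`. -/
def ofMono (i : ℤ) : 𝒢 (i : ZMod n) →ₗ[ℂ] AffineAlgebra 𝒢 B hB hs where
  toFun x := ⟨⟨mono i x, mono_mem_twistedLoop 𝒢 x.2⟩, 0, 0⟩
  map_add' x y := by
    ext1
    · exact Subtype.ext ((monoLinear i).map_add (x : 𝔤) y)
    · simp
    · simp
  map_smul' c x := by
    ext1
    · exact Subtype.ext ((monoLinear i).map_smul c (x : 𝔤))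
    · simp
    · simp

lemma coe_ofMono_loop (i : ℤ) (x : 𝒢 (i : ZMod n)) :
    ((ofMono 𝒢 B hB hs i x).loop : loopAlgebra ℂ ℤ 𝔤) = mono i (x : 𝔤) := rfl

@[simp] lemma ofMono_dCoeff (i : ℤ) (x : 𝒢 (i : ZMod n)) :
    (ofMono 𝒢 B hB hs i x).dCoeff = 0 := rfl

@[simp] lemma ofMono_zCoeff (i : ℤ) (x : 𝒢 (i : ZMod n)) :
    (ofMono 𝒢 B hB hs i x).zCoeff = 0 := rfl

@[simp] lemma d_loop : (d 𝒢 B hB hs).loop = 0 := rfl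
@[simp] lemma d_dCoeff : (d 𝒢 B hB hs).dCoeff = 1 := rfl
@[simp] lemma d_zCoeff : (d 𝒢 B hB hs).zCoeff = 0 := rfl
@[simp] lemma z_loop : (z 𝒢 B hB hs).loop = 0 := rfl
@[simp] lemma z_dCoeff : (z 𝒢 B hB hs).dCoeff = 0 := rfl
@[simp] lemma z_zCoeff : (z 𝒢 B hB hs).zCoeff = 1 := rfl

variable (𝒢 B hB hs) in
/-- The coefficient in `𝔤` of `t ^ i`, as a linear map on the affine algebra. -/
def loopCoeff (i : ℤ) : AffineAlgebra 𝒢 B hB hs →ₗ[ℂ] 𝔤 where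
  toFun u := coeff u.loop i
  map_add' _ _ := coeff_add _ _ i
  map_smul' c _ := coeff_smul c _ i

lemma loopCoeff_apply (i : ℤ) (u : AffineAlgebra 𝒢 B hB hs) :
    loopCoeff 𝒢 B hB hs i u = coeff u.loop i := rfl

lemma loopCoeff_mem (i : ℤ) (u : AffineAlgebra 𝒢 B hB hs) :
    loopCoeff 𝒢 B hB hs i u ∈ 𝒢 (i : ZMod n) := u.loop.2 i

lemma loopCoeff_ofMono (i j : ℤ) (x : 𝒢 (i : ZMod n)) :
    loopCoeff 𝒢 B hB hs j (ofMono 𝒢 B hB hs i x) = if i = j then (x : 𝔤) else 0 :=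
  coeff_mono i j _

@[simp] lemma loopCoeff_d (i : ℤ) : loopCoeff 𝒢 B hB hs i (d 𝒢 B hB hs) = 0 := coeff_zero i

@[simp] lemma loopCoeff_z (i : ℤ) : loopCoeff 𝒢 B hB hs i (z 𝒢 B hB hs) = 0 := coeff_zero i

lemma ext_loopCoeff {u v : AffineAlgebra 𝒢 B hB hs}
    (h : ∀ i, loopCoeff 𝒢 B hB hs i u = loopCoeff 𝒢 B hB hs i v)
    (hd : u.dCoeff = v.dCoeff) (hz : u.zCoeff = v.zCoeff) : u = v :=
  AffineAlgebra.ext (Subtype.ext (ext_coeff h)) hd hz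

lemma loopCoeff_d_lie (i : ℤ) (u : AffineAlgebra 𝒢 B hB hs) :
    loopCoeff 𝒢 B hB hs i ⁅d 𝒢 B hB hs, u⁆ = (i : ℂ) • loopCoeff 𝒢 B hB hs i u := by
  have : ⁅d 𝒢 B hB hs, u⁆.loop = twistedEuler 𝒢 u.loop := by simp
  rw [loopCoeff_apply, this, coe_twistedEuler, coeff_euler, loopCoeff_apply]

lemma loopCoeff_lie_ofMono (u : AffineAlgebra 𝒢 B hB hs) (j m : ℤ) (y : 𝒢 (j : ZMod n)) :
    loopCoeff 𝒢 B hB hs (m + j) ⁅u, ofMono 𝒢 B hB hs j y⁆ =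
      ⁅loopCoeff 𝒢 B hB hs m u, (y : 𝔤)⁆ + if m = 0 then (u.dCoeff * j) • (y : 𝔤) else 0 := by
  have h : ((⁅u, ofMono 𝒢 B hB hs j y⁆.loop : twistedLoop 𝒢) : loopAlgebra ℂ ℤ 𝔤) =
      ⁅(u.loop : loopAlgebra ℂ ℤ 𝔤), mono j (y : 𝔤)⁆ +
        (u.dCoeff * j) • mono j (y : 𝔤) := by
    rw [mul_smul, ← euler_mono]
    simp [coe_twistedEuler, coe_ofMono_loop]
  rw [loopCoeff_apply, h, coeff_add, coeff_smul, coeff_lie_mono, coeff_mono, loopCoeff_apply]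
  by_cases hm : m = 0
  · simp [hm]
  · rw [if_neg hm, if_neg (by omega), smul_zero]

lemma isHomogeneous_ofMono (i : ℤ) (x : 𝒢 (i : ZMod n)) :
    IsHomogeneous i (ofMono 𝒢 B hB hs i x) :=
  ext_loopCoeff (fun j ↦ by
    rw [loopCoeff_d_lie, map_smul, loopCoeff_ofMono]
    split_ifs with h
    · subst h; rfl
    · simp) (by simp) (by simp)

lemma isHomogeneous_zero (i : ℤ) : IsHomogeneous i (0 : AffineAlgebra 𝒢 B hB hs) := by
  simp [IsHomogeneous]

lemma IsHomogeneous.lie {i j : ℤ} {u v : AffineAlgebra 𝒢 B hB hs} (hu : IsHomogeneous i u)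
    (hv : IsHomogeneous j v) : IsHomogeneous (i + j) ⁅u, v⁆ := by
  unfold IsHomogeneous at *
  rw [leibniz_lie, hu, hv, smul_lie, lie_smul, ← add_smul]
  push_cast
  rfl

variable (𝒢 B hB hs) in
/-- The projection of the affine algebra onto its homogeneous component of degree `m`. -/
def comp (m : ℤ) : AffineAlgebra 𝒢 B hB hs →ₗ[ℂ] AffineAlgebra 𝒢 B hB hs where
  toFun u := ofMono 𝒢 B hB hs m ⟨loopCoeff 𝒢 B hB hs m u, loopCoeff_mem m u⟩ +
    if m = 0 then u.dCoeff • d 𝒢 B hB hs + u.zCoeff • z 𝒢 B hB hs else 0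
  map_add' u v := by
    refine ext_loopCoeff (fun j ↦ ?_) ?_ ?_
    · split_ifs <;> by_cases h : m = j <;> simp [loopCoeff_ofMono, h]
    · split_ifs <;> simp
    · split_ifs <;> simp
  map_smul' c u := by
    refine ext_loopCoeff (fun j ↦ ?_) ?_ ?_
    · split_ifs <;> by_cases h : m = j <;> simp [loopCoeff_ofMono, h]
    · split_ifs <;> simp
    · split_ifs <;> simp

lemma comp_apply (m : ℤ) (u : AffineAlgebra 𝒢 B hB hs) :
    comp 𝒢 B hB hs m u = ofMono 𝒢 B hB hs m ⟨loopCoeff 𝒢 B hB hs m u, loopCoeff_mem m u⟩ +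
      if m = 0 then u.dCoeff • d 𝒢 B hB hs + u.zCoeff • z 𝒢 B hB hs else 0 := rfl

lemma loopCoeff_comp (m j : ℤ) (u : AffineAlgebra 𝒢 B hB hs) :
    loopCoeff 𝒢 B hB hs j (comp 𝒢 B hB hs m u) =
      if m = j then loopCoeff 𝒢 B hB hs m u else 0 := by
  rw [comp_apply, map_add, loopCoeff_ofMono]
  by_cases h : m = 0 <;> simp [h]

lemma comp_dCoeff (m : ℤ) (u : AffineAlgebra 𝒢 B hB hs) :
    (comp 𝒢 B hB hs m u).dCoeff = if m = 0 then u.dCoeff else 0 := by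
  rw [comp_apply]
  by_cases h : m = 0 <;> simp [h]

lemma comp_zCoeff (m : ℤ) (u : AffineAlgebra 𝒢 B hB hs) :
    (comp 𝒢 B hB hs m u).zCoeff = if m = 0 then u.zCoeff else 0 := by
  rw [comp_apply]
  by_cases h : m = 0 <;> simp [h]

lemma IsHomogeneous.loopCoeff_eq_zero {i j : ℤ} {u : AffineAlgebra 𝒢 B hB hs}
    (hu : IsHomogeneous i u) (hij : i ≠ j) : loopCoeff 𝒢 B hB hs j u = 0 := by
  have h := loopCoeff_d_lie j u
  rw [hu, map_smul, ← sub_eq_zero, ← sub_smul] at h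
  exact (smul_eq_zero.mp h).resolve_left (sub_ne_zero.mpr (by exact_mod_cast hij))

lemma IsHomogeneous.dCoeff_eq_zero {i : ℤ} {u : AffineAlgebra 𝒢 B hB hs}
    (hu : IsHomogeneous i u) (hi : i ≠ 0) : u.dCoeff = 0 := by
  simpa [hi] using (congrArg dCoeff hu).symm

lemma IsHomogeneous.zCoeff_eq_zero {i : ℤ} {u : AffineAlgebra 𝒢 B hB hs}
    (hu : IsHomogeneous i u) (hi : i ≠ 0) : u.zCoeff = 0 := by
  have h := congrArg zCoeff hu
  simpa [hi] using h.symm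

lemma IsHomogeneous.comp_self {i : ℤ} {u : AffineAlgebra 𝒢 B hB hs} (hu : IsHomogeneous i u) :
    comp 𝒢 B hB hs i u = u := by
  refine ext_loopCoeff (fun j ↦ ?_) ?_ ?_
  · rw [loopCoeff_comp]
    split_ifs with h
    · rw [h]
    · rw [hu.loopCoeff_eq_zero h]
  · rw [comp_dCoeff]
    split_ifs with h
    · rfl
    · rw [hu.dCoeff_eq_zero h]
  · rw [comp_zCoeff]
    split_ifs with h
    · rfl
    · rw [hu.zCoeff_eq_zero h]

lemma IsHomogeneous.comp_of_ne {i m : ℤ} {u : AffineAlgebra 𝒢 B hB hs} (hu : IsHomogeneous i u)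
    (him : i ≠ m) : comp 𝒢 B hB hs m u = 0 := by
  refine ext_loopCoeff (fun j ↦ ?_) ?_ ?_
  · rw [loopCoeff_comp, hu.loopCoeff_eq_zero him, ite_self, map_zero]
  · rw [comp_dCoeff]
    split_ifs with h
    · exact hu.dCoeff_eq_zero (h ▸ him)
    · rfl
  · rw [comp_zCoeff]
    split_ifs with h
    · exact hu.zCoeff_eq_zero (h ▸ him)
    · rfl

lemma isHomogeneous_comp (m : ℤ) (u : AffineAlgebra 𝒢 B hB hs) :
    IsHomogeneous m (comp 𝒢 B hB hs m u) := by
  refine ext_loopCoeff (fun j ↦ ?_) ?_ ?_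
  · rw [loopCoeff_d_lie, map_smul, loopCoeff_comp]
    split_ifs with h
    · rw [h]
    · simp
  · rw [smul_dCoeff, comp_dCoeff, lie_dCoeff]
    split_ifs with h <;> simp [h]
  · rw [smul_zCoeff, comp_zCoeff, lie_zCoeff]
    split_ifs with h <;> simp [h]

lemma eq_zero_of_forall_comp_eq_zero {u : AffineAlgebra 𝒢 B hB hs}
    (h : ∀ m, comp 𝒢 B hB hs m u = 0) : u = 0 := by
  refine ext_loopCoeff (fun j ↦ ?_) ?_ ?_
  · have := loopCoeff_comp j j u
    rw [h, if_pos rfl] at this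
    rw [← this]
  · have := comp_dCoeff 0 u
    rw [h, if_pos rfl] at this
    rw [← this]
  · have := comp_zCoeff 0 u
    rw [h, if_pos rfl] at this
    rw [← this]

lemma homogeneous_induction {p : AffineAlgebra 𝒢 B hB hs → Prop} (u : AffineAlgebra 𝒢 B hB hs)
    (hadd : ∀ u v, p u → p v → p (u + v)) (hom : ∀ i u, IsHomogeneous i u → p u) : p u := by
  have key (s : Finset ℤ) : ∀ u, (∀ m ∉ s, comp 𝒢 B hB hs m u = 0) → p u := by
    induction s using Finset.induction_on with
    | empty =>
      intro u hu
      rw [eq_zero_of_forall_comp_eq_zero fun m ↦ hu m (Finset.notMem_empty m)]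
      exact hom 0 0 (isHomogeneous_zero 0)
    | insert a s ha ih =>
      intro u hu
      rw [← add_sub_cancel (comp 𝒢 B hB hs a u) u]
      refine hadd _ _ (hom a _ (isHomogeneous_comp a u)) (ih _ fun m hm ↦ ?_)
      rw [map_sub]
      by_cases hma : m = a
      · rw [hma, (isHomogeneous_comp a u).comp_self, sub_self]
      · rw [(isHomogeneous_comp a u).comp_of_ne (Ne.symm hma), hu m (by simp [hm, hma]), sub_zero]
  -- Degree 0 is added because `t d/dt` and `z` live there, whether or not the loop part does.
  refine key (insert 0 (toFinsupp ℂ ℤ 𝔤 u.loop).support) u fun m hm ↦ ?_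
  rw [Finset.mem_insert, not_or, Finsupp.notMem_support_iff] at hm
  have h : loopCoeff 𝒢 B hB hs m u = 0 := hm.2
  refine ext_loopCoeff (fun j ↦ ?_) ?_ ?_
  · rw [loopCoeff_comp, h, ite_self, map_zero]
  · rw [comp_dCoeff, if_neg hm.1]; rfl
  · rw [comp_zCoeff, if_neg hm.1]; rfl

lemma comp_lie {j : ℤ} {y : AffineAlgebra 𝒢 B hB hs} (hy : IsHomogeneous j y) (m : ℤ)
    (u : AffineAlgebra 𝒢 B hB hs) :
    comp 𝒢 B hB hs m ⁅u, y⁆ = ⁅comp 𝒢 B hB hs (m - j) u, y⁆ := by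
  induction u using homogeneous_induction with
  | hadd u v hu hv => rw [add_lie, map_add, map_add, add_lie, hu, hv]
  | hom i u hu =>
    by_cases h : i + j = m
    · rw [show m - j = i by omega, hu.comp_self, ← h, (hu.lie hy).comp_self]
    · rw [hu.comp_of_ne (show i ≠ m - j by omega), (hu.lie hy).comp_of_ne h, zero_lie]

lemma comp_d_lie (m : ℤ) (u : AffineAlgebra 𝒢 B hB hs) :
    comp 𝒢 B hB hs m ⁅d 𝒢 B hB hs, u⁆ = (m : ℂ) • comp 𝒢 B hB hs m u := by
  induction u using homogeneous_induction with
  | hadd u v hu hv => rw [lie_add, map_add, map_add, smul_add, hu, hv]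
  | hom i u hu =>
    rw [hu, map_smul]
    by_cases h : i = m
    · rw [h]
    · rw [hu.comp_of_ne h, smul_zero, smul_zero]

lemma IsHomogeneous.eq_ofMono {i : ℤ} {u : AffineAlgebra 𝒢 B hB hs} (hu : IsHomogeneous i u)
    (hi : i ≠ 0) : ofMono 𝒢 B hB hs i ⟨loopCoeff 𝒢 B hB hs i u, loopCoeff_mem i u⟩ = u := by
  conv_rhs => rw [← hu.comp_self, comp_apply, if_neg hi, add_zero]

lemma loopCoeff_lie_of_dCoeff_eq_zero {u : AffineAlgebra 𝒢 B hB hs} (hu : u.dCoeff = 0) (j m : ℤ)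
    (y : 𝒢 (j : ZMod n)) :
    loopCoeff 𝒢 B hB hs (m + j) ⁅u, ofMono 𝒢 B hB hs j y⁆ =
      ⁅loopCoeff 𝒢 B hB hs m u, (y : 𝔤)⁆ := by
  rw [loopCoeff_lie_ofMono, hu]
  simp

variable (𝒢 B hB hs) in
lemma z_lie (u : AffineAlgebra 𝒢 B hB hs) : ⁅z 𝒢 B hB hs, u⁆ = 0 := by
  refine AffineAlgebra.ext ?_ ?_ ?_ <;> simp

/-! ### Consequences of simplicity: center, double brackets, derived algebra -/

section Simple

variable [NeZero n] [LieAlgebra.IsSimple ℂ 𝔤]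

/-- An element commuting with the homogeneous elements of almost all degrees is a multiple of
`z`. -/
lemma eq_smul_z_of_forall_lie_eq_zero {u : AffineAlgebra 𝒢 B hB hs} (S : Finset ℤ)
    (h : ∀ j ∉ S, ∀ y : AffineAlgebra 𝒢 B hB hs, IsHomogeneous j y → ⁅u, y⁆ = 0) : u = u.zCoeff • z 𝒢 B hB hs := by
  have hT (j : ℤ) (hj : j ∉ S) (y : 𝒢 (j : ZMod n)) (m : ℤ) :
      ⁅loopCoeff 𝒢 B hB hs m u, (y : 𝔤)⁆ + (if m = 0 then (u.dCoeff * j) • (y : 𝔤) else 0) = 0 := by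
    rw [← loopCoeff_lie_ofMono, h j hj _ (isHomogeneous_ofMono j y), map_zero]
  have hd : u.dCoeff = 0 := by
    by_contra hd
    refine LieAlgebra.IsSimple.non_abelian ℂ (L := 𝔤) ⟨fun a b ↦ ?_⟩
    have ha : a = 0 := by
      refine induction_homogeneous (p := fun a ↦ a = 0) 𝒢 a
        (fun x y hx hy ↦ by rw [hx, hy, add_zero]) fun s x hx ↦ ?_
      obtain ⟨i, rfl, hi⟩ := exists_intCast_eq_notMem s S
      -- The same `x` in degrees `i` and `j`: the bracket terms agree, so the difference of the two
      -- relations is `u.dCoeff * (j - i)` times `x`. A nonzero `u.dCoeff` would therefore force 𝔤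
      -- to be zero.
      obtain ⟨j, hj, hjS⟩ := exists_intCast_eq_notMem (i : ZMod n) (insert i S)
      rw [Finset.mem_insert, not_or] at hjS
      have h1 := hT i hi ⟨x, hx⟩ 0
      have h2 := hT j hjS.2 ⟨x, hj ▸ hx⟩ 0
      rw [if_pos rfl] at h1 h2
      have h3 : (u.dCoeff * ((j : ℂ) - i)) • x = 0 := by
        rw [mul_sub, sub_smul]
        exact sub_eq_zero.mpr (add_left_cancel (h2.trans h1.symm))
      refine (smul_eq_zero.mp h3).resolve_left (mul_ne_zero hd (sub_ne_zero.mpr ?_))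
      exact_mod_cast hjS.1
    rw [ha, zero_lie]
  have hc (m : ℤ) : loopCoeff 𝒢 B hB hs m u = 0 := by
    refine eq_zero_of_forall_lie_homogeneous_eq_zero 𝒢 fun s y hy ↦ ?_
    obtain ⟨i, rfl, hi⟩ := exists_intCast_eq_notMem s S
    simpa [hd] using hT i hi ⟨y, hy⟩ m
  refine ext_loopCoeff (fun j ↦ ?_) ?_ ?_
  · rw [hc, map_smul, loopCoeff_z, smul_zero]
  · simp [hd]
  · simp

/-- In terms of the coefficient `c` of `v`, moving `i` within its class mod `n` changes only the
factor `k + i`. Hence `⁅⁅c, y⁆, x⁆ = 0` for all homogeneous `x`, `y`, and the trivial center of 𝔤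
gives `c = 0`. As `k ≠ 0`, `v` has no `t d/dt` or `z` part. -/
lemma eq_zero_of_forall_smul_lie_lie_eq {k : ℤ} (hk : k ≠ 0) {v : AffineAlgebra 𝒢 B hB hs}
    (hv : IsHomogeneous k v)
    (h : ∀ i j : ℤ, i ≠ 0 → j ≠ 0 → ∀ x y : AffineAlgebra 𝒢 B hB hs,
      IsHomogeneous i x → IsHomogeneous j y →
      ((k : ℂ) + i) • ⁅⁅v, y⁆, x⁆ = ((k : ℂ) + j) • ⁅⁅v, x⁆, y⁆) : v = 0 := by
  set c := loopCoeff 𝒢 B hB hs k v with hc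
  have hT (i j : ℤ) (hi : i ≠ 0) (hj : j ≠ 0) (x : 𝒢 (i : ZMod n)) (y : 𝒢 (j : ZMod n)) :
      ((k : ℂ) + i) • ⁅⁅c, (y : 𝔤)⁆, (x : 𝔤)⁆ = ((k : ℂ) + j) • ⁅⁅c, (x : 𝔤)⁆, (y : 𝔤)⁆ := by
    have h1 := congrArg (loopCoeff 𝒢 B hB hs (k + j + i))
      (h i j hi hj _ _ (isHomogeneous_ofMono i x) (isHomogeneous_ofMono j y))
    have hvd := hv.dCoeff_eq_zero hk
    rw [map_smul, map_smul, loopCoeff_lie_of_dCoeff_eq_zero (lie_dCoeff _ _),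
      loopCoeff_lie_of_dCoeff_eq_zero hvd, add_right_comm k j i,
      loopCoeff_lie_of_dCoeff_eq_zero (lie_dCoeff _ _), loopCoeff_lie_of_dCoeff_eq_zero hvd] at h1
    exact h1
  have hc0 : c = 0 := by
    refine eq_zero_of_forall_lie_homogeneous_eq_zero 𝒢 fun s y hy ↦
      eq_zero_of_forall_lie_homogeneous_eq_zero 𝒢 fun r x hx ↦ ?_
    obtain ⟨j, rfl, hj⟩ := exists_intCast_eq_notMem s {0}
    obtain ⟨i, rfl, hi⟩ := exists_intCast_eq_notMem r {0}
    obtain ⟨i', hii, hi'⟩ := exists_intCast_eq_notMem (i : ZMod n) {0, i}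
    simp only [Finset.mem_insert, Finset.mem_singleton, not_or] at hj hi hi'
    have h1 := hT i j hi hj ⟨x, hx⟩ ⟨y, hy⟩
    have h2 := hT i' j hi'.1 hj ⟨x, hii ▸ hx⟩ ⟨y, hy⟩
    have h3 := h2.trans h1.symm
    rw [← sub_eq_zero, ← sub_smul, add_sub_add_left_eq_sub] at h3
    refine (smul_eq_zero.mp h3).resolve_left (sub_ne_zero.mpr ?_)
    exact_mod_cast hi'.2
  rw [← hv.eq_ofMono hk]
  simp only [← hc, hc0]
  exact map_zero _

/-- A linear map vanishing on all brackets factors through the coefficient of `t d/dt`. -/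
lemma eq_dCoeff_smul_of_forall_map_lie_eq_zero [FiniteDimensional ℂ 𝔤] (hB0 : B ≠ 0)
    {M : Type*} [AddCommGroup M] [Module ℂ M] (f : AffineAlgebra 𝒢 B hB hs →ₗ[ℂ] M)
    (hf : ∀ u v : AffineAlgebra 𝒢 B hB hs, f ⁅u, v⁆ = 0) (u : AffineAlgebra 𝒢 B hB hs) :
    f u = u.dCoeff • f (d 𝒢 B hB hs) := by
  have hne (i : ℤ) (hi : i ≠ 0) (u) (hu : IsHomogeneous i u) : f u = 0 := by
    have := hf (d 𝒢 B hB hs) u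
    rw [hu, map_smul] at this
    exact (smul_eq_zero.mp this).resolve_left (by exact_mod_cast hi)
  have hmem {i j : ℤ} (hij : i + j = 0) {x y : 𝔤} (hx : x ∈ 𝒢 (i : ZMod n))
      (hy : y ∈ 𝒢 (j : ZMod n)) : ⁅x, y⁆ ∈ 𝒢 ((0 : ℤ) : ZMod n) := by
    have := SetLike.GradedBracket.bracket_mem hx hy
    rwa [← Int.cast_add, hij] at this
  have hlie {i j : ℤ} (hij : i + j = 0) {x y : 𝔤} (hx : x ∈ 𝒢 (i : ZMod n))
      (hy : y ∈ 𝒢 (j : ZMod n)) : ⁅ofMono 𝒢 B hB hs i ⟨x, hx⟩, ofMono 𝒢 B hB hs j ⟨y, hy⟩⁆ =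
      ofMono 𝒢 B hB hs 0 ⟨⁅x, y⁆, hmem hij hx hy⟩ + ((i : ℂ) * B y x) • z 𝒢 B hB hs := by
    refine AffineAlgebra.ext (Subtype.ext ?_) (by simp) ?_
    · simp [coe_ofMono_loop, lie_mono, hij]
    · simp [coe_ofMono_loop, cocycle_mono, hij]
  have hsum {i j : ℤ} (hij : i + j = 0) {x y : 𝔤} (hx : x ∈ 𝒢 (i : ZMod n))
      (hy : y ∈ 𝒢 (j : ZMod n)) :
      f (ofMono 𝒢 B hB hs 0 ⟨⁅x, y⁆, hmem hij hx hy⟩) +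
        ((i : ℂ) * B y x) • f (z 𝒢 B hB hs) = 0 := by
    rw [← map_smul, ← map_add, ← hlie hij hx hy, hf]
  have hz : f (z 𝒢 B hB hs) = 0 := by
    obtain ⟨s, x, hx, y, hy, hxy⟩ := exists_homogeneous_apply_ne_zero 𝒢 hB hB0
    obtain ⟨i, rfl, -⟩ := exists_intCast_eq_notMem s ∅
    -- The brackets of `x ⊗ t ^ i` with `y ⊗ t ^ (-i)` and of `x ⊗ t ^ i'` with `y ⊗ t ^ (-i')`
    -- differ by a nonzero multiple of `z`.
    obtain ⟨i', hi, hi'⟩ := exists_intCast_eq_notMem (i : ZMod n) {i}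
    rw [Finset.mem_singleton] at hi'
    have h1 := hsum (add_neg_cancel i) hx (y := y) (by simpa using hy)
    have h2 := hsum (add_neg_cancel i') (hi ▸ hx) (y := y) (by simpa [hi] using hy)
    have h3 := add_left_cancel (h2.trans h1.symm)
    rw [← sub_eq_zero, ← sub_smul, ← sub_mul, hs.eq y x] at h3
    refine (smul_eq_zero.mp h3).resolve_left (mul_ne_zero (sub_ne_zero.mpr ?_) hxy)
    exact_mod_cast hi'
  -- The degree-zero component of 𝔤 need not be perfect, but 𝔤 is; so `f` on degree zero is extended
  -- to 𝔤 through the projection, and the extension kills all homogeneous brackets.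
  let P : 𝔤 →ₗ[ℂ] M := f ∘ₗ ofMono 𝒢 B hB hs 0 ∘ₗ
    DirectSum.component ℂ (ZMod n) (fun i ↦ 𝒢 i) ((0 : ℤ) : ZMod n) ∘ₗ
      (DirectSum.decomposeLinearEquiv 𝒢).toLinearMap
  have hP (x : 𝔤) (hx : x ∈ 𝒢 ((0 : ℤ) : ZMod n)) : P x = f (ofMono 𝒢 B hB hs 0 ⟨x, hx⟩) :=
    congrArg (fun a ↦ f (ofMono 𝒢 B hB hs 0 a)) (Subtype.ext (DirectSum.decompose_of_mem_same 𝒢 hx))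
  have hP0 : P = 0 := by
    refine eq_zero_of_forall_map_lie_homogeneous 𝒢 P fun r x hx s y hy ↦ ?_
    by_cases hrs : r + s = 0
    · obtain ⟨i, rfl, -⟩ := exists_intCast_eq_notMem r ∅
      obtain rfl := eq_neg_of_add_eq_zero_right hrs
      have hy' : y ∈ 𝒢 ((-i : ℤ) : ZMod n) := by simpa using hy
      rw [hP _ (hmem (add_neg_cancel i) hx hy')]
      simpa [hz] using hsum (add_neg_cancel i) hx hy'
    · have h0 : DirectSum.component ℂ (ZMod n) (fun i ↦ 𝒢 i) ((0 : ℤ) : ZMod n)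
          (DirectSum.decomposeLinearEquiv 𝒢 ⁅x, y⁆) = 0 :=
        Subtype.ext (DirectSum.decompose_of_mem_ne 𝒢 (SetLike.GradedBracket.bracket_mem hx hy)
          (by simpa using hrs))
      change f (ofMono 𝒢 B hB hs 0 (DirectSum.component ℂ (ZMod n) (fun i ↦ 𝒢 i) ((0 : ℤ) : ZMod n)
          (DirectSum.decomposeLinearEquiv 𝒢 ⁅x, y⁆))) = 0
      rw [h0, map_zero, map_zero]
  induction u using homogeneous_induction with
  | hadd u v hu hv => rw [map_add, hu, hv, add_dCoeff, add_smul]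
  | hom i u hu =>
    by_cases hi : i = 0
    · subst hi
      conv_lhs => rw [← hu.comp_self, comp_apply, if_pos rfl]
      rw [map_add, map_add, map_smul, map_smul, hz, smul_zero, add_zero, ← hP, hP0,
        LinearMap.zero_apply, zero_add]
    · rw [hne i hi u hu, hu.dCoeff_eq_zero hi, zero_smul]

end Simple

/-! ### Rigidity of CPA-structures -/

section Biderivation

variable {n : ℕ} {𝔤 : Type*} [LieRing 𝔤] [LieAlgebra ℂ 𝔤]
  {𝒢 : ZMod n → Submodule ℂ 𝔤} [GradedLieAlgebra 𝒢]
  {B : LinearMap.BilinForm ℂ 𝔤} {hB : B.lieInvariant 𝔤} {hs : B.IsSymm}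
  {Φ : AffineAlgebra 𝒢 B hB hs →ₗ[ℂ] AffineAlgebra 𝒢 B hB hs →ₗ[ℂ] AffineAlgebra 𝒢 B hB hs}

lemma map_lie_eq_add (hΦ : IsCPAStructure Φ) (u x y : AffineAlgebra 𝒢 B hB hs) :
    Φ u ⁅x, y⁆ = ⁅Φ u x, y⁆ + ⁅x, Φ u y⁆ := by
  rw [hΦ.map_lie_right, ← lie_skew x, sub_eq_add_neg]

lemma smul_map_homogeneous (hΦ : IsCPAStructure Φ) {i : ℤ} {x : AffineAlgebra 𝒢 B hB hs}
    (hx : IsHomogeneous i x) (u : AffineAlgebra 𝒢 B hB hs) :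
    (i : ℂ) • Φ u x = ⁅Φ u (d 𝒢 B hB hs), x⁆ + ⁅d 𝒢 B hB hs, Φ u x⁆ := by
  rw [← map_lie_eq_add hΦ, hx, map_smul]

/-- The degree `m` part of `smul_map_homogeneous`. For `m ≠ i` it determines the component of `Φ u
x` from `Φ u d`; for `m = i` it says that the degree-zero part of `Φ u d` commutes with `x`. -/
lemma smul_comp_map_homogeneous (hΦ : IsCPAStructure Φ) {i : ℤ} {x : AffineAlgebra 𝒢 B hB hs}
    (hx : IsHomogeneous i x) (u : AffineAlgebra 𝒢 B hB hs) (m : ℤ) :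
    ((i : ℂ) - m) • comp 𝒢 B hB hs m (Φ u x) =
      ⁅comp 𝒢 B hB hs (m - i) (Φ u (d 𝒢 B hB hs)), x⁆ := by
  rw [sub_smul, ← map_smul, smul_map_homogeneous hΦ hx, map_add, comp_d_lie, add_sub_cancel_right,
    comp_lie hx]

/-- Two uses of the previous lemma, one per variable, reduce `Φ y x` to `Φ d d`. The left factor is
not symmetric in `i` and `j` while `Φ` is commutative, which is what `comp_map_d_d_eq_zero`
exploits. -/
lemma smul_smul_comp_map_homogeneous (hΦ : IsCPAStructure Φ) {i j : ℤ}
    {x y : AffineAlgebra 𝒢 B hB hs} (hx : IsHomogeneous i x) (hy : IsHomogeneous j y) (k : ℤ) :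
    ((k : ℂ) * (k + j)) • comp 𝒢 B hB hs (k + i + j) (Φ y x) =
      ⁅⁅comp 𝒢 B hB hs k (Φ (d 𝒢 B hB hs) (d 𝒢 B hB hs)), y⁆, x⁆ := by
  have h1 := smul_comp_map_homogeneous hΦ hx y (k + i + j)
  have h2 := smul_comp_map_homogeneous hΦ hy (d 𝒢 B hB hs) (k + j)
  rw [show k + i + j - i = k + j by ring, hΦ.comm y (d 𝒢 B hB hs)] at h1
  rw [add_sub_cancel_right] at h2
  rw [← h2, smul_lie, ← h1, smul_smul]
  congr 1
  push_cast
  ring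

variable [NeZero n] [LieAlgebra.IsSimple ℂ 𝔤]

lemma comp_map_d_d_eq_zero (hΦ : IsCPAStructure Φ) {k : ℤ} (hk : k ≠ 0) :
    comp 𝒢 B hB hs k (Φ (d 𝒢 B hB hs) (d 𝒢 B hB hs)) = 0 := by
  refine eq_zero_of_forall_smul_lie_lie_eq hk (isHomogeneous_comp k _) fun i j _ _ x y hx hy ↦ ?_
  rw [← smul_smul_comp_map_homogeneous hΦ hx hy, ← smul_smul_comp_map_homogeneous hΦ hy hx,
    hΦ.comm x y, add_right_comm k j i, smul_smul, smul_smul]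
  congr 1
  ring

lemma map_d_d_lie_eq_zero (hΦ : IsCPAStructure Φ) {i : ℤ} {x : AffineAlgebra 𝒢 B hB hs}
    (hx : IsHomogeneous i x) : ⁅Φ (d 𝒢 B hB hs) (d 𝒢 B hB hs), x⁆ = 0 := by
  refine eq_zero_of_forall_comp_eq_zero fun m ↦ ?_
  rw [comp_lie hx]
  by_cases h : m = i
  -- Only the degree-zero part of `Φ d d` contributes here, and it commutes with `x`.
  · rw [h, ← smul_comp_map_homogeneous hΦ hx, sub_self, zero_smul]
  · rw [comp_map_d_d_eq_zero hΦ (sub_ne_zero.mpr h), zero_lie]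

lemma isHomogeneous_map_d (hΦ : IsCPAStructure Φ) {i : ℤ} {x : AffineAlgebra 𝒢 B hB hs}
    (hx : IsHomogeneous i x) : IsHomogeneous i (Φ (d 𝒢 B hB hs) x) := by
  have h := smul_map_homogeneous hΦ hx (d 𝒢 B hB hs)
  rw [map_d_d_lie_eq_zero hΦ hx, zero_add] at h
  exact h.symm

/-- Both sides equal `-i j` times the degree `i + j` component of `Φ x y`, computed from either
variable. -/
lemma smul_map_d_lie (hΦ : IsCPAStructure Φ) {i j : ℤ} {x y : AffineAlgebra 𝒢 B hB hs}
    (hx : IsHomogeneous i x) (hy : IsHomogeneous j y) :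
    (j : ℂ) • ⁅Φ (d 𝒢 B hB hs) x, y⁆ = (i : ℂ) • ⁅Φ (d 𝒢 B hB hs) y, x⁆ := by
  have h1 := smul_comp_map_homogeneous hΦ hy x (i + j)
  have h2 := smul_comp_map_homogeneous hΦ hx y (i + j)
  rw [add_sub_cancel_right, hΦ.comm x (d 𝒢 B hB hs),
    (isHomogeneous_map_d hΦ hx).comp_self] at h1
  rw [add_sub_cancel_left, hΦ.comm y (d 𝒢 B hB hs), hΦ.comm y x,
    (isHomogeneous_map_d hΦ hy).comp_self] at h2
  rw [← h1, ← h2, smul_smul, smul_smul]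
  congr 1
  push_cast
  ring

/-- On homogeneous elements of degree zero, `Φ (t d/dt)` takes values in the line spanned by
`z`. -/
lemma map_d_eq_smul_z (hΦ : IsCPAStructure Φ) {x : AffineAlgebra 𝒢 B hB hs}
    (hx : IsHomogeneous 0 x) :
    Φ (d 𝒢 B hB hs) x = (Φ (d 𝒢 B hB hs) x).zCoeff • z 𝒢 B hB hs := by
  refine eq_smul_z_of_forall_lie_eq_zero {0} fun j hj y hy ↦ ?_
  have h := smul_map_d_lie hΦ hx hy
  rw [Int.cast_zero, zero_smul] at h
  rw [Finset.mem_singleton] at hj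
  exact (smul_eq_zero.mp h).resolve_left (by exact_mod_cast hj)

lemma smul_map_d_map_lie (hΦ : IsCPAStructure Φ) {i j : ℤ} {x y : AffineAlgebra 𝒢 B hB hs}
    (hx : IsHomogeneous i x) (hy : IsHomogeneous j y) :
    (i : ℂ) • Φ (d 𝒢 B hB hs) ⁅x, y⁆ = ((i : ℂ) - j) • ⁅Φ (d 𝒢 B hB hs) x, y⁆ := by
  rw [hΦ.map_lie_right, smul_sub, ← smul_map_d_lie hΦ hx hy, sub_smul]

/-- `smul_map_d_map_lie` computes `D` on a triple bracket in two ways, through `⁅x, ⁅y, w⁆⁆` and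
through its Jacobi expansion. The discrepancy is the double-bracket identity for `D x`, multiplied
by `2 j k`. -/
lemma map_d_eq_zero (hΦ : IsCPAStructure Φ) {i : ℤ} (hi : i ≠ 0) {x : AffineAlgebra 𝒢 B hB hs}
    (hx : IsHomogeneous i x) : Φ (d 𝒢 B hB hs) x = 0 := by
  refine eq_zero_of_forall_smul_lie_lie_eq hi (isHomogeneous_map_d hΦ hx)
    fun k j hk hj w y hw hy ↦ ?_
  set D := Φ (d 𝒢 B hB hs) with hD
  -- `i (i + j) D [[x, y], w] = (i + j - k) (i - j) [[D x, y], w]`, and its variants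
  have twice {j k : ℤ} {y w : AffineAlgebra 𝒢 B hB hs} (hy : IsHomogeneous j y)
      (hw : IsHomogeneous k w) : ((i : ℂ) * (i + j)) • D ⁅⁅x, y⁆, w⁆ =
        (((i : ℂ) + j - k) * (i - j)) • ⁅⁅D x, y⁆, w⁆ := by
    have h := smul_map_d_map_lie hΦ (hx.lie hy) hw
    rw [Int.cast_add] at h
    rw [mul_smul, h, smul_comm, ← smul_lie, smul_map_d_map_lie hΦ hx hy, smul_lie, smul_smul]
  have h1 := twice hy hw
  have h2 := twice hw hy
  have h3 := smul_map_d_map_lie hΦ hx (hy.lie hw)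
  have e1 : ⁅x, ⁅y, w⁆⁆ = ⁅⁅x, y⁆, w⁆ - ⁅⁅x, w⁆, y⁆ := by
    rw [leibniz_lie, ← lie_skew y]; abel
  have e2 : ⁅D x, ⁅y, w⁆⁆ = ⁅⁅D x, y⁆, w⁆ - ⁅⁅D x, w⁆, y⁆ := by
    rw [leibniz_lie, ← lie_skew y]; abel
  rw [← hD, e1, e2, map_sub, Int.cast_add] at h3
  have hjk : (2 * (j : ℂ) * k) ≠ 0 := by
    refine mul_ne_zero (mul_ne_zero two_ne_zero ?_) ?_ <;> assumption_mod_cast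
  refine smul_right_injective _ hjk ?_
  beta_reduce
  -- The multipliers give every term containing `D` of a triple bracket the common factor `i (i + j)
  -- (i + k)`, so these terms cancel.
  linear_combination (norm := module) (((i : ℂ) + j) * (i + k)) • h3 - ((i : ℂ) + k) • h1 +
    ((i : ℂ) + j) • h2

lemma map_d_lie_eq_zero (hΦ : IsCPAStructure Φ) {i : ℤ} {x : AffineAlgebra 𝒢 B hB hs}
    (hx : IsHomogeneous i x) (y : AffineAlgebra 𝒢 B hB hs) : ⁅Φ (d 𝒢 B hB hs) x, y⁆ = 0 := by
  by_cases hi : i = 0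
  · subst hi
    rw [map_d_eq_smul_z hΦ hx, smul_lie, z_lie, smul_zero]
  · rw [map_d_eq_zero hΦ hi hx, zero_lie]

lemma isHomogeneous_map_right (hΦ : IsCPAStructure Φ) {i j : ℤ} {x y : AffineAlgebra 𝒢 B hB hs}
    (hx : IsHomogeneous i x) (hy : IsHomogeneous j y) : IsHomogeneous j (Φ x y) := by
  have h := smul_map_homogeneous hΦ hy x
  rw [hΦ.comm x (d 𝒢 B hB hs), map_d_lie_eq_zero hΦ hx, zero_add] at h
  exact h.symm

/-- By commutativity `Φ x y` is homogeneous of degree `i` as well as `j`. -/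
lemma map_eq_zero_of_ne (hΦ : IsCPAStructure Φ) {i j : ℤ} (hij : i ≠ j)
    {x y : AffineAlgebra 𝒢 B hB hs} (hx : IsHomogeneous i x) (hy : IsHomogeneous j y) :
    Φ x y = 0 := by
  rw [← (isHomogeneous_map_right hΦ hx hy).comp_self, hΦ.comm x y]
  exact (isHomogeneous_map_right hΦ hy hx).comp_of_ne hij

/-- A CPA-structure on the affine algebra takes values in the line spanned by `z`. -/
lemma map_eq_smul_z (hΦ : IsCPAStructure Φ) (u v : AffineAlgebra 𝒢 B hB hs) :
    Φ u v = (Φ u v).zCoeff • z 𝒢 B hB hs := by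
  induction u using homogeneous_induction with
  | hadd u₁ u₂ h₁ h₂ =>
    rw [map_add, LinearMap.add_apply, add_zCoeff, add_smul, ← h₁, ← h₂]
  | hom i x hx =>
    induction v using homogeneous_induction with
    | hadd v₁ v₂ h₁ h₂ => rw [map_add, add_zCoeff, add_smul, ← h₁, ← h₂]
    | hom j y hy =>
      by_cases hij : i = j
      · subst hij
        -- For `w` of degree `k`, `k ≠ i` gives `Φ x w = 0`, and `k ≠ 0` makes the degree `i + k` of
        -- `⁅y, w⁆` differ from `i`, so `Φ x ⁅y, w⁆ = 0`. The derivation rule leaves `⁅Φ x y, w⁆ =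
        -- 0`.
        refine eq_smul_z_of_forall_lie_eq_zero {0, i} fun k hk w hw ↦ ?_
        simp only [Finset.mem_insert, Finset.mem_singleton, not_or] at hk
        have h := hΦ.map_lie_right x y w
        rw [map_eq_zero_of_ne hΦ (Ne.symm hk.2) hx hw, zero_lie, sub_zero,
          map_eq_zero_of_ne hΦ (by omega) hx (hy.lie hw)] at h
        exact h.symm
      · rw [map_eq_zero_of_ne hΦ hij hx hy, zero_zCoeff, zero_smul]

lemma map_lie_eq_zero (hΦ : IsCPAStructure Φ) (u v w : AffineAlgebra 𝒢 B hB hs) :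
    Φ u ⁅v, w⁆ = 0 := by
  rw [hΦ.map_lie_right, map_eq_smul_z hΦ u v, map_eq_smul_z hΦ u w, smul_lie, smul_lie, z_lie,
    z_lie, smul_zero, smul_zero, sub_zero]

/-- A CPA-structure on the affine algebra is a multiple of `eulerSquare`. -/
theorem eq_smul_eulerSquare [FiniteDimensional ℂ 𝔤] (hB0 : B ≠ 0) (hΦ : IsCPAStructure Φ) :
    Φ = (Φ (d 𝒢 B hB hs) (d 𝒢 B hB hs)).zCoeff • eulerSquare 𝒢 B hB hs := by
  refine LinearMap.ext₂ fun u v ↦ ?_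
  rw [eq_dCoeff_smul_of_forall_map_lie_eq_zero hB0 (Φ u) (map_lie_eq_zero hΦ u), hΦ.comm u,
    eq_dCoeff_smul_of_forall_map_lie_eq_zero hB0 (Φ _) (map_lie_eq_zero hΦ _),
    map_eq_smul_z hΦ (d 𝒢 B hB hs) (d 𝒢 B hB hs), LinearMap.smul_apply, LinearMap.smul_apply,
    eulerSquare_apply, smul_smul, smul_smul, smul_smul, smul_zCoeff, z_zCoeff]
  congr 1
  ring

end Biderivation

/-! ### The multiples of `eulerSquare` are CPA-structures -/

section EulerSquare

variable {n : ℕ} {𝔤 : Type*} [LieRing 𝔤] [LieAlgebra ℂ 𝔤]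
  (𝒢 : ZMod n → Submodule ℂ 𝔤) [GradedLieAlgebra 𝒢]
  (B : LinearMap.BilinForm ℂ 𝔤) (hB : B.lieInvariant 𝔤) (hs : B.IsSymm)

/-- Brackets and values of `eulerSquare` have zero `t d/dt` coefficient, and the values are central,
so every term of the last two axioms vanishes. -/
lemma isCPAStructure_smul_eulerSquare (c : ℂ) :
    IsCPAStructure (c • eulerSquare 𝒢 B hB hs) where
  comm x y := by simp [eulerSquare_apply, mul_comm]
  map_lie_right x y w := by simp [eulerSquare_apply, smul_lie, z_lie]
  map_lie_left x y w := by simp [eulerSquare_apply]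

lemma eulerSquare_ne_zero : eulerSquare 𝒢 B hB hs ≠ 0 := fun h ↦ by
  have h1 := congrArg (fun Ψ ↦ (Ψ (d 𝒢 B hB hs) (d 𝒢 B hB hs)).zCoeff) h
  simp [eulerSquare_apply] at h1

end EulerSquare

end AffineAlgebra

end KacMoody

end

theorem theorem4p3 {n : ℕ} [NeZero n] {𝔤 : Type*} [LieRing 𝔤] [LieAlgebra ℂ 𝔤]
    [FiniteDimensional ℂ 𝔤] [LieAlgebra.IsSimple ℂ 𝔤]
    (𝒢 : ZMod n → Submodule ℂ 𝔤) [GradedLieAlgebra 𝒢]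
    (B : LinearMap.BilinForm ℂ 𝔤) (hB : B.lieInvariant 𝔤) (hs : B.IsSymm) (hB0 : B ≠ 0) :
    {Φ : KacMoody.AffineAlgebra 𝒢 B hB hs →ₗ[ℂ] KacMoody.AffineAlgebra 𝒢 B hB hs →ₗ[ℂ]
        KacMoody.AffineAlgebra 𝒢 B hB hs | IsCPAStructure Φ} =
      (Submodule.span ℂ {KacMoody.AffineAlgebra.eulerSquare 𝒢 B hB hs} : Set _) ∧
    Module.finrank ℂ (Submodule.span ℂ {KacMoody.AffineAlgebra.eulerSquare 𝒢 B hB hs}) = 1 := by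
  refine ⟨Set.ext fun Φ ↦ ⟨fun hΦ ↦ ?_, fun hΦ ↦ ?_⟩,
    finrank_span_singleton (KacMoody.AffineAlgebra.eulerSquare_ne_zero 𝒢 B hB hs)⟩
  · rw [KacMoody.AffineAlgebra.eq_smul_eulerSquare hB0 hΦ]
    exact Submodule.smul_mem _ _ (Submodule.mem_span_singleton_self _)
  · obtain ⟨c, rfl⟩ := Submodule.mem_span_singleton.mp hΦ
    exact KacMoody.AffineAlgebra.isCPAStructure_smul_eulerSquare 𝒢 B hB hs c
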